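/- Let $\xi>0$, $S=[-\xi,\xi]$, $\nu>0$, $0\le\beta<1$, $U>0$ and $L\ge 0$. There is a constant $C$, depending only on $\xi,\nu,\beta,U,L$, such that the following holds for every horizon $T\ge 1$. Let $u^1,\dots,u^T:S\to\mathbb R$ be a fixed sequence of concave, differentiable, $L$-Lipschitz functions with $|u^t|\le U$ on $S$. Put $r=R=\xi$ and $$\nu^t=\frac{\nu}{\sqrt t},\qquad \sigma=T^{-1/4}\sqrt{\frac{RUr}{3(Lr+U)}},\qquad \alpha=\frac{\sigma}{r}.$$ Let $c^1,\dots,c^T$ be independent random unit vectors of $\mathbb R$, each uniform on $\{-1,1\}$, and run bandit gradient ascent with momentum: start with $y^1=0$, $v^0=0$ and, for $t=1,\dots,T$, play $z^t=y^t+\sigma c^t$, form the one-point gradient estimate $g^t=\frac1\sigma u^t(z^t)c^t$, and update $$v^t=\beta v^{t-1}+\sigma g^t,\qquad y^{t+1}=P_{(1-\alpha)S}\bigl(y^t+\nu^t v^t\bigr),$$ where $P_{(1-\alpha)S}$ is the Euclidean (nearest-point) projection onto $(1-\alpha)S$. Suppose that, almost surely, $|g^t|\le G$ for all $t\in\{1,\dots,T\}$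 and $|y^i-y^j|\le D$ for all $i,j\in\{1,\dots,T\}$, for some real $G$ and some $D>0$. Then the regret $$R(T)=\max_{z\in S}\sum_{t=1}^T u^t(z)-\sum_{t=1}^T u^t(z^t)$$ is integrable and $$\mathbb E[R(T)]\le C\,T^{3/4}\sqrt{1+\log T},$$ so that $\mathbb E[R(T)]\le\tilde{\mathcal O}(T^{3/4})$. (The constant $C$ does not depend on $T$, on the functions $u^t$, on $G$ or on $D$.) -/

import Mathlib

open MeasureTheory ProbabilityTheory
open scoped NNReal Pointwise

noncomputable section

namespace BGAM

/-- Euclidean projection of `x` onto `K ⊆ ℝ`: a point of `K` nearest to `x`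
(it exists and is unique when `K` is a nonempty compact interval). -/
def proj (K : Set ℝ) (x : ℝ) : ℝ :=
  Classical.epsilon fun p => p ∈ K ∧ ∀ q ∈ K, |p - x| ≤ |q - x|

theorem proj_spec {K : Set ℝ} (hK : IsCompact K) (hne : K.Nonempty) (x : ℝ) :
    proj K x ∈ K ∧ ∀ q ∈ K, |proj K x - x| ≤ |q - x| := by
  have h : ∃ p, p ∈ K ∧ ∀ q ∈ K, |p - x| ≤ |q - x| := by
    obtain ⟨p, hp, hmin⟩ := hK.exists_isMinOn hne
      (f := fun p => |p - x|) (by fun_prop)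
    exact ⟨p, hp, fun q hq => hmin hq⟩
  exact Classical.epsilon_spec h

/-- The one-point gradient estimate `g = (1/σ) u(y + σ c) c`. -/
def gradEst (σ : ℝ) (u : ℝ → ℝ) (y c : ℝ) : ℝ :=
  1 / σ * (u (y + σ * c) * c)

/-- The state `(y^{n+1}, v^n)` of bandit gradient ascent with momentum after `n` rounds, for the
strategy space `S`, step sizes `ν t`, smoothing radius `σ`, shrinkage `α`, momentum coefficient
`β`, utilities `u t` and drawn unit vectors `c t` (`t = 1, 2, …`). It starts from `y^1 = 0` and
zero momentum; round `t` performs `v^t = β v^{t-1} + σ g^t` and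
`y^{t+1} = P_{(1-α)S}(y^t + ν^t v^t)`. -/
def state (S : Set ℝ) (ν : ℕ → ℝ) (σ α β : ℝ) (u : ℕ → ℝ → ℝ) (c : ℕ → ℝ) : ℕ → ℝ × ℝ
  | 0 => (0, 0)
  | n + 1 =>
    let y := (state S ν σ α β u c n).1
    let v := β * (state S ν σ α β u c n).2 + σ * gradEst σ (u (n + 1)) y (c (n + 1))
    (proj ((1 - α) • S) (y + ν (n + 1) * v), v)

/-- The iterate `y^t`, for `t ≥ 1`. -/
def iterate (S : Set ℝ) (ν : ℕ → ℝ) (σ α β : ℝ) (u : ℕ → ℝ → ℝ) (c : ℕ → ℝ) (t : ℕ) : ℝ :=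
  (state S ν σ α β u c (t - 1)).1

/-- The played (shifted) action `z^t = y^t + σ c^t`, for `t ≥ 1`. -/
def action (S : Set ℝ) (ν : ℕ → ℝ) (σ α β : ℝ) (u : ℕ → ℝ → ℝ) (c : ℕ → ℝ) (t : ℕ) : ℝ :=
  iterate S ν σ α β u c t + σ * c t

/-- The regret `max_{z ∈ S} ∑_{t=1}^T u^t(z) - ∑_{t=1}^T u^t(z^t)` of a sequence of actions. -/
def regret (S : Set ℝ) (u : ℕ → ℝ → ℝ) (T : ℕ) (z : ℕ → ℝ) : ℝ :=
  sSup ((fun x => ∑ t ∈ Finset.Icc 1 T, u t x) '' S) - ∑ t ∈ Finset.Icc 1 T, u t (z t)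

/-- The smoothing radius `σ = T^{-1/4} √(R U r / (3 (L r + U)))`. -/
def radius (T : ℕ) (R r L U : ℝ) : ℝ :=
  (T : ℝ) ^ (-(1 / 4) : ℝ) * √(R * U * r / (3 * (L * r + U)))

/-- The step sizes `ν^t = ν / √t`. -/
def stepSize (ν : ℝ) (t : ℕ) : ℝ := ν / √(t : ℝ)

end BGAM

end

noncomputable section

namespace BGAM

/-! The scaled estimate `σ * g^t = u^t(z^t) c^t` is bounded by `U` whatever `σ` is, so the momenta
stay below `U / (1 - β)`. Projected steps of size `ν / √t` therefore have linear regret `A √T` for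
the increments `σ * g^t`, with `A` free of `σ` (`sum_increment_mul_le_sqrt`).

Flipping `c^t` leaves `y^t` unchanged, so on average the increment is `(u^t(y + σ) - u^t(y - σ)) /
2`, which is `σ` times a symmetric difference quotient (`sum_signed_value_eq`). By concavity that
quotient acts as a supergradient up to `2 L σ` (`concave_sub_le_symmDiffQuot`). Shrinking the
comparator and perturbing the action cost `L σ` each, whence an expected regret of at most `A √T / σ
+ 4 L σ T`; with `σ` of order `T^(-1/4)` both terms are of order `T^(3/4)`.

The utilities are fixed in advance, so the best comparator is not random and a bound for each fixed
comparator suffices. The signs take finitely many values, so expectations are averages over the cube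
of bit strings. -/

theorem smul_Icc_neg {ξ σ : ℝ} (hξ : 0 < ξ) (hσ : σ < ξ) :
    (1 - σ / ξ) • Set.Icc (-ξ) ξ = Set.Icc (-(ξ - σ)) (ξ - σ) := by
  have h : 0 < 1 - σ / ξ := by rw [sub_pos, div_lt_one hξ]; exact hσ
  have h' : (1 - σ / ξ) * ξ = ξ - σ := by field_simp
  rw [← Set.image_smul]
  simp only [smul_eq_mul]
  rw [Set.image_mul_left_Icc' h, mul_neg, h']

/-- Projecting onto an interval does not increase the distance to its points. -/
theorem abs_proj_Icc_sub_le {l r : ℝ} (hlr : l ≤ r) (x : ℝ) {q : ℝ} (hq : q ∈ Set.Icc l r) :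
    |proj (Set.Icc l r) x - q| ≤ |x - q| := by
  obtain ⟨⟨hl, hr⟩, hmin⟩ := proj_spec (isCompact_Icc (a := l) (b := r)) ⟨l, le_rfl, hlr⟩ x
  generalize proj (Set.Icc l r) x = p at *
  obtain ⟨hq1, hq2⟩ := hq
  rcases lt_or_ge x l with h | h
  · have := hmin l ⟨le_rfl, hlr⟩
    rw [abs_of_nonneg (by linarith), abs_of_nonneg (by linarith)] at this
    rw [abs_of_nonpos (by linarith), abs_of_nonpos (by linarith)]
    linarith
  rcases lt_or_ge r x with h' | h'
  · have := hmin r ⟨hlr, le_rfl⟩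
    rw [abs_of_nonpos (by linarith), abs_of_nonpos (by linarith)] at this
    rw [abs_of_nonneg (by linarith), abs_of_nonneg (by linarith)]
    linarith
  · have := hmin x ⟨h, h'⟩
    rw [sub_self, abs_zero, abs_nonpos_iff, sub_eq_zero] at this
    rw [this]

theorem proj_Icc_mem {l r : ℝ} (hlr : l ≤ r) (x : ℝ) :
    proj (Set.Icc l r) x ∈ Set.Icc l r :=
  (proj_spec isCompact_Icc ⟨l, le_rfl, hlr⟩ x).1

/-! ### Linear regret with momentum -/

/-- With `b² - a² = 1` one has `2 b (b - a) = 1 + (b - a)²`. This makes sums of step sizes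
telescope. -/
theorem inv_sqrt_succ_le (n : ℕ) :
    1 / √((n + 1 : ℕ) : ℝ) ≤ 2 * (√((n + 1 : ℕ) : ℝ) - √(n : ℝ)) := by
  have hb : 0 < √((n + 1 : ℕ) : ℝ) := Real.sqrt_pos.2 (by positivity)
  have ha : 0 ≤ √(n : ℝ) := Real.sqrt_nonneg _
  have hb2 : √((n + 1 : ℕ) : ℝ) ^ 2 = n + 1 := by
    rw [Real.sq_sqrt (by positivity)]; push_cast; ring
  have ha2 : √(n : ℝ) ^ 2 = n := Real.sq_sqrt (by positivity)
  rw [div_le_iff₀ hb]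
  nlinarith [sq_nonneg (√((n + 1 : ℕ) : ℝ) - √(n : ℝ))]

/-- Linear regret of projected steps of size `ν / √(n + 1)` along the directions `v (n + 1)`. -/
theorem sum_momentum_mul_le {N : ℕ} {y v : ℕ → ℝ} {z D V ν : ℝ} (hν : 0 < ν)
    (hD : ∀ n ≤ N, |y n - z| ≤ D) (hV : ∀ n ≤ N, |v n| ≤ V)
    (hstep : ∀ n < N, |y (n + 1) - z| ≤ |y n + stepSize ν (n + 1) * v (n + 1) - z|) :
    ∑ n ∈ Finset.range N, v (n + 1) * (z - y n) + √(N : ℝ) / (2 * ν) * (y N - z) ^ 2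
      ≤ (D ^ 2 / (2 * ν) + V ^ 2 * ν) * √(N : ℝ) := by
  induction N with
  | zero => simp
  | succ N ih =>
    have ih := ih (fun n hn => hD n (by omega)) (fun n hn => hV n (by omega))
      (fun n hn => hstep n (by omega))
    rw [Finset.sum_range_succ]
    have hb : 0 < √((N + 1 : ℕ) : ℝ) := Real.sqrt_pos.2 (by positivity)
    have hab : √(N : ℝ) ≤ √((N + 1 : ℕ) : ℝ) := Real.sqrt_le_sqrt (by simp)
    have h1 := sq_le_sq.2 (hstep N (by omega))
    have h2 : v (N + 1) ^ 2 ≤ V ^ 2 :=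
      sq_le_sq' (abs_le.1 (hV _ le_rfl)).1 (abs_le.1 (hV _ le_rfl)).2
    have h3 : (y N - z) ^ 2 ≤ D ^ 2 :=
      sq_le_sq' (abs_le.1 (hD N (by omega))).1 (abs_le.1 (hD N (by omega))).2
    have h4 := inv_sqrt_succ_le N
    simp only [stepSize] at h1
    generalize √((N + 1 : ℕ) : ℝ) = b at *
    generalize √(N : ℝ) = a at *
    -- The weight `b / (2 ν)` is the one for which the cross term of the expanded square is exactly
    -- the linear regret of this step.
    have e1 : v (N + 1) * (z - y N) + b / (2 * ν) * (y (N + 1) - z) ^ 2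
        ≤ b / (2 * ν) * (y N - z) ^ 2 + ν / 2 * (1 / b) * v (N + 1) ^ 2 := by
      have : b / (2 * ν) * (y (N + 1) - z) ^ 2
          ≤ b / (2 * ν) * (y N + ν / b * v (N + 1) - z) ^ 2 := by gcongr
      have e : b / (2 * ν) * (y N + ν / b * v (N + 1) - z) ^ 2 =
          b / (2 * ν) * (y N - z) ^ 2 + ν / 2 * (1 / b) * v (N + 1) ^ 2
            - v (N + 1) * (z - y N) := by field_simp; ring
      linarith
    have e2 : ν / 2 * (1 / b) * v (N + 1) ^ 2 ≤ ν / 2 * (2 * (b - a)) * V ^ 2 := by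
      have : 0 ≤ 2 * (b - a) := by linarith
      gcongr
    -- Raising the weight of the potential from `a` to `b` is paid for by the diameter.
    have e3 : (b - a) / (2 * ν) * (y N - z) ^ 2 ≤ (b - a) / (2 * ν) * D ^ 2 := by
      have : 0 ≤ b - a := by linarith
      gcongr
    have e4 : (D ^ 2 / (2 * ν) + V ^ 2 * ν) * b - (D ^ 2 / (2 * ν) + V ^ 2 * ν) * a
        = (b - a) / (2 * ν) * D ^ 2 + ν / 2 * (2 * (b - a)) * V ^ 2 := by ring
    have e5 : (b - a) / (2 * ν) * (y N - z) ^ 2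
      = b / (2 * ν) * (y N - z) ^ 2 - a / (2 * ν) * (y N - z) ^ 2 := by ring
    linarith

/-- The increments `x n = v (n + 1) - β v n` compared with the momenta themselves. -/
theorem sum_increment_mul_le {N : ℕ} {y v x : ℕ → ℝ} {z V ν β : ℝ} (hν : 0 < ν) (hβ : 0 ≤ β)
    (hv0 : v 0 = 0) (hrec : ∀ n < N, v (n + 1) = β * v n + x n)
    (hV : ∀ n ≤ N, |v n| ≤ V)
    (hmove : ∀ n < N, |y (n + 1) - y n| ≤ stepSize ν (n + 1) * |v (n + 1)|) :
    ∑ n ∈ Finset.range N, x n * (z - y n)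
      ≤ (1 - β) * ∑ n ∈ Finset.range N, v (n + 1) * (z - y n) + β * (v N * (z - y N))
        + 2 * β * V ^ 2 * ν * √(N : ℝ) := by
  induction N with
  | zero => simp [hv0]
  | succ N ih =>
    have ih := ih (fun n hn => hrec n (by omega)) (fun n hn => hV n (by omega))
      (fun n hn => hmove n (by omega))
    rw [Finset.sum_range_succ, Finset.sum_range_succ]
    have hx := hrec N (by omega)
    have hb : 0 < √((N + 1 : ℕ) : ℝ) := Real.sqrt_pos.2 (by positivity)
    have h4 := inv_sqrt_succ_le N
    have hm := hmove N (by omega)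
    have hv := hV (N + 1) le_rfl
    simp only [stepSize] at hm
    generalize √((N + 1 : ℕ) : ℝ) = b at *
    generalize √(N : ℝ) = a at *
    -- Summation by parts leaves a boundary term at `N` and this drift, of second order in the
    -- momentum.
    have key : v (N + 1) * (y (N + 1) - y N) ≤ 2 * V ^ 2 * ν * (b - a) := by
      calc v (N + 1) * (y (N + 1) - y N) ≤ |v (N + 1)| * |y (N + 1) - y N| := by
            rw [← abs_mul]; exact le_abs_self _
        _ ≤ |v (N + 1)| * (ν / b * |v (N + 1)|) := by gcongr
        _ = ν * (1 / b) * |v (N + 1)| ^ 2 := by ring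
        _ ≤ ν * (2 * (b - a)) * V ^ 2 := by
            have : 0 ≤ 1 / b := by positivity
            have : 0 ≤ 2 * (b - a) := by linarith
            gcongr
        _ = _ := by ring
    have key' := mul_le_mul_of_nonneg_left key hβ
    have hx' : x N = v (N + 1) - β * v N := by linarith
    rw [hx']
    linear_combination ih + key'

/-- `U / (1 - β)` is the fixed point of `V ↦ β V + U`. -/
theorem abs_momentum_le {N : ℕ} {v x : ℕ → ℝ} {β U : ℝ} (hβ0 : 0 ≤ β) (hβ1 : β < 1) (hU : 0 ≤ U)
    (hv0 : v 0 = 0) (hrec : ∀ n < N, v (n + 1) = β * v n + x n) (hx : ∀ n < N, |x n| ≤ U) :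
    ∀ n ≤ N, |v n| ≤ U / (1 - β) := by
  have h1 : 0 < 1 - β := by linarith
  intro n
  induction n with
  | zero => intro _; rw [hv0, abs_zero]; positivity
  | succ n ih =>
    intro hn
    rw [hrec n hn]
    calc |β * v n + x n| ≤ |β * v n| + |x n| := abs_add_le _ _
      _ ≤ β * (U / (1 - β)) + U := by
          rw [abs_mul, abs_of_nonneg hβ0]
          have := ih (by omega)
          have := hx n hn
          gcongr
      _ = U / (1 - β) := by field_simp; ring

theorem sum_increment_mul_le_sqrt {N : ℕ} (hN : 1 ≤ N) {y v x : ℕ → ℝ} {z D U ν β : ℝ}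
    (hν : 0 < ν) (hβ0 : 0 ≤ β) (hβ1 : β < 1) (hU : 0 ≤ U)
    (hv0 : v 0 = 0) (hrec : ∀ n < N, v (n + 1) = β * v n + x n) (hx : ∀ n < N, |x n| ≤ U)
    (hD : ∀ n ≤ N, |y n - z| ≤ D)
    (hstep : ∀ n < N, |y (n + 1) - z| ≤ |y n + stepSize ν (n + 1) * v (n + 1) - z|)
    (hmove : ∀ n < N, |y (n + 1) - y n| ≤ stepSize ν (n + 1) * |v (n + 1)|) :
    ∑ n ∈ Finset.range N, x n * (z - y n)
      ≤ (D ^ 2 / (2 * ν) + 3 * (U / (1 - β)) ^ 2 * ν + U / (1 - β) * D) * √(N : ℝ) := by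
  have hV := abs_momentum_le hβ0 hβ1 hU hv0 hrec hx
  have h1 := sum_momentum_mul_le hν hD hV hstep
  have h2 := sum_increment_mul_le (z := z) hν hβ0 hv0 hrec hV hmove
  have hV0 : 0 ≤ U / (1 - β) := div_nonneg hU (by linarith)
  have hvz : v N * (z - y N) ≤ U / (1 - β) * D := by
    calc v N * (z - y N) ≤ |v N| * |y N - z| := by
          rw [abs_sub_comm, ← abs_mul]; exact le_abs_self _
      _ ≤ _ := by have := hV N le_rfl; have := hD N le_rfl; gcongr
  have hD0 : 0 ≤ D := (abs_nonneg _).trans (hD 0 (by omega))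
  generalize U / (1 - β) = V at *
  -- Lets the boundary term `V * D` be absorbed into the multiple of `√N`.
  have hs : 1 ≤ √(N : ℝ) := Real.one_le_sqrt.2 (by exact_mod_cast hN)
  have hsq : 0 ≤ √(N : ℝ) / (2 * ν) * (y N - z) ^ 2 := by positivity
  have h3 : (1 - β) * ∑ n ∈ Finset.range N, v (n + 1) * (z - y n)
      ≤ 1 * ((D ^ 2 / (2 * ν) + V ^ 2 * ν) * √(N : ℝ)) := by
    calc _ ≤ (1 - β) * ((D ^ 2 / (2 * ν) + V ^ 2 * ν) * √(N : ℝ)) := by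
          have : 0 ≤ 1 - β := by linarith
          gcongr; linarith
      _ ≤ _ := by gcongr; linarith
  have h4 : β * (v N * (z - y N)) ≤ 1 * (V * D) * √(N : ℝ) := by
    calc _ ≤ β * (V * D) := by gcongr
      _ ≤ 1 * (V * D) := by gcongr
      _ ≤ _ := le_mul_of_one_le_right (by positivity) hs
  have h5 : 2 * β * V ^ 2 * ν * √(N : ℝ) ≤ 2 * 1 * V ^ 2 * ν * √(N : ℝ) := by gcongr
  linarith

/-! ### Concavity without derivatives -/

/-- Concavity with the symmetric difference quotient in place of the derivative, up to an error
proportional to the width of the quotient. -/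
theorem concave_sub_le_symmDiffQuot {S : Set ℝ} {u : ℝ → ℝ} {L : ℝ≥0} {y z σ : ℝ}
    (hc : ConcaveOn ℝ S u) (hL : LipschitzOnWith L u S) (hσ : 0 < σ)
    (hz : z ∈ S) (hyp : y + σ ∈ S) (hym : y - σ ∈ S) :
    u z - u y ≤ (u (y + σ) - u (y - σ)) / (2 * σ) * (z - y) + 2 * L * σ := by
  have hy : y ∈ S := by
    have := hc.1 hyp hym (by norm_num : (0 : ℝ) ≤ 1 / 2) (by norm_num : (0 : ℝ) ≤ 1 / 2)
      (by norm_num)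
    simp only [smul_eq_mul] at this
    convert this using 1; ring
  have lip : ∀ a ∈ S, ∀ b ∈ S, |u a - u b| ≤ L * |a - b| := fun a ha b hb => by
    simpa [Real.dist_eq] using hL.dist_le_mul a ha b hb
  have hd : |(u (y + σ) - u (y - σ)) / (2 * σ)| ≤ L := by
    rw [abs_div, abs_of_pos (by positivity : 0 < 2 * σ), div_le_iff₀ (by positivity)]
    have := lip _ hyp _ hym
    rwa [show y + σ - (y - σ) = 2 * σ by ring, abs_of_pos (by positivity : 0 < 2 * σ)] at this
  have hslope : (u (y + σ) - u (y - σ)) / ((y + σ) - (y - σ))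
      = (u (y + σ) - u (y - σ)) / (2 * σ) := by congr 1; ring
  have hp := lip _ hyp _ hy
  have hm := lip _ hym _ hy
  rw [show y + σ - y = σ by ring, abs_of_pos hσ, abs_le] at hp
  rw [show y - σ - y = -σ by ring, abs_neg, abs_of_pos hσ, abs_le] at hm
  set d := (u (y + σ) - u (y - σ)) / (2 * σ) with hd_def
  rw [abs_le] at hd
  have hdσ1 : d * σ ≤ L * σ := by gcongr; exact hd.2
  have hdσ2 : -(L * σ) ≤ d * σ := by have := mul_le_mul_of_nonneg_right hd.1 hσ.le; linarith
  -- Outside the window `[y - σ, y + σ]` slopes are compared by concavity; inside it, both sides are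
  -- of size `L σ` by the Lipschitz bound.
  rcases lt_or_ge (y + σ) z with h | h
  · have := hc.slope_anti_adjacent hym hz (by linarith : y - σ < y + σ) h
    rw [hslope, div_le_iff₀ (by linarith)] at this
    linarith
  rcases lt_or_ge z (y - σ) with h' | h'
  · have := hc.slope_anti_adjacent hz hyp h' (by linarith : y - σ < y + σ)
    rw [hslope, le_div_iff₀ (by linarith)] at this
    linarith
  · have hzy : |z - y| ≤ σ := by rw [abs_le]; constructor <;> linarith
    have h1 := (le_abs_self _).trans (lip _ hz _ hy)
    have h2 : -(d * (z - y)) ≤ L * |z - y| := by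
      calc -(d * (z - y)) ≤ |d| * |z - y| := by rw [← abs_mul]; exact neg_le_abs _
        _ ≤ _ := by gcongr; exact abs_le.2 hd
    have h3 : (L : ℝ) * |z - y| ≤ L * σ := by gcongr
    linarith

/-! ### Dependence on past signs only -/

theorem state_congr (S : Set ℝ) (ν : ℕ → ℝ) (σ α β : ℝ) (u : ℕ → ℝ → ℝ) {c c' : ℕ → ℝ} {n : ℕ}
    (h : ∀ s, 1 ≤ s → s ≤ n → c s = c' s) : state S ν σ α β u c n = state S ν σ α β u c' n := by
  induction n with
  | zero => rfl
  | succ n ih =>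
    simp only [state, ih fun s h1 h2 => h s h1 (by omega), h (n + 1) (by omega) le_rfl]

/-- The inequality `s < t` is strict: `y^t` is chosen before `c^t` is drawn, which is what makes
flipping `c^t` harmless. -/
theorem iterate_congr (S : Set ℝ) (ν : ℕ → ℝ) (σ α β : ℝ) (u : ℕ → ℝ → ℝ) {c c' : ℕ → ℝ} {t : ℕ}
    (h : ∀ s, 1 ≤ s → s < t → c s = c' s) :
    iterate S ν σ α β u c t = iterate S ν σ α β u c' t := by
  rw [iterate, iterate, state_congr]
  exact fun s h1 h2 => h s h1 (by omega)

theorem regret_action_congr (S : Set ℝ) (ν : ℕ → ℝ) (σ α β : ℝ) (u : ℕ → ℝ → ℝ) {c c' : ℕ → ℝ}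
    {T : ℕ} (h : ∀ s ∈ Finset.Icc 1 T, c s = c' s) :
    regret S u T (action S ν σ α β u c) = regret S u T (action S ν σ α β u c') := by
  simp only [regret]
  congr 1
  refine Finset.sum_congr rfl fun t ht => ?_
  have ht' := Finset.mem_Icc.1 ht
  rw [action, action, h t ht, iterate_congr]
  exact fun s h1 h2 => h s (Finset.mem_Icc.2 ⟨h1, by omega⟩)

/-! ### Bounds for a fixed sign sequence -/

section Deterministic

variable {ξ σ : ℝ}

theorem state_fst_mem (hξ : 0 < ξ) (hσξ : σ < ξ) (ν : ℕ → ℝ) (β : ℝ)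
    (u : ℕ → ℝ → ℝ) (c : ℕ → ℝ) (n : ℕ) :
    (state (Set.Icc (-ξ) ξ) ν σ (σ / ξ) β u c n).1 ∈ Set.Icc (-(ξ - σ)) (ξ - σ) := by
  cases n with
  | zero => simp only [state, Set.mem_Icc]; constructor <;> linarith
  | succ n =>
    simp only [state]
    rw [smul_Icc_neg hξ hσξ]
    exact proj_Icc_mem (by linarith) _

/-- Linear regret of the iterates against any point of the shrunken interval. -/
theorem sum_signed_value_mul_le {ν β U : ℝ} (hξ : 0 < ξ) (hσ : 0 < σ) (hσξ : σ < ξ)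
    (hν : 0 < ν) (hβ0 : 0 ≤ β) (hβ1 : β < 1) (hU : 0 ≤ U) {T : ℕ} (hT : 1 ≤ T)
    {u : ℕ → ℝ → ℝ} (hu : ∀ t ∈ Finset.Icc 1 T, ∀ z ∈ Set.Icc (-ξ) ξ, |u t z| ≤ U)
    {c : ℕ → ℝ} (hc : ∀ s, c s = 1 ∨ c s = -1) {z : ℝ} (hz : z ∈ Set.Icc (-(ξ - σ)) (ξ - σ))
    {y : ℕ → ℝ} (hy : y = iterate (Set.Icc (-ξ) ξ) (stepSize ν) σ (σ / ξ) β u c) :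
    ∑ t ∈ Finset.Icc 1 T, u t (y t + σ * c t) * c t * (z - y t)
      ≤ ((2 * ξ) ^ 2 / (2 * ν) + 3 * (U / (1 - β)) ^ 2 * ν + U / (1 - β) * (2 * ξ))
        * √(T : ℝ) := by
  set st := state (Set.Icc (-ξ) ξ) (stepSize ν) σ (σ / ξ) β u c with hst
  have hmem : ∀ n, (st n).1 ∈ Set.Icc (-(ξ - σ)) (ξ - σ) :=
    state_fst_mem hξ hσξ (stepSize ν) β u c
  have hlr : -(ξ - σ) ≤ ξ - σ := by linarith
  -- The factor `σ` cancels the `1 / σ` of the estimate, leaving an increment bounded by `U`.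
  have hv : ∀ n, (st (n + 1)).2
      = β * (st n).2 + u (n + 1) ((st n).1 + σ * c (n + 1)) * c (n + 1) := fun n => by
    simp only [hst, state, gradEst]
    field_simp
  have hy1 : ∀ n, (st (n + 1)).1
      = proj (Set.Icc (-(ξ - σ)) (ξ - σ)) ((st n).1 + stepSize ν (n + 1) * (st (n + 1)).2) :=
    fun n => by
      rw [← smul_Icc_neg hξ hσξ]
      simp only [hst, state]
  -- Index shift `t = n + 1`: `st n` holds `y^{n+1}` and `v^n`.
  have hsum : ∑ t ∈ Finset.Icc 1 T, u t (y t + σ * c t) * c t * (z - y t)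
      = ∑ n ∈ Finset.range T,
        u (n + 1) ((st n).1 + σ * c (n + 1)) * c (n + 1) * (z - (st n).1) := by
    rw [← Finset.Ico_succ_right_eq_Icc, Finset.sum_Ico_eq_sum_range]
    simp [hy, iterate, hst, add_comm]
  have hcabs : ∀ s, |c s| = 1 := fun s => by rcases hc s with h | h <;> simp [h]
  rw [hsum]
  refine sum_increment_mul_le_sqrt hT (y := fun n => (st n).1) (v := fun n => (st n).2)
    (x := fun n => u (n + 1) ((st n).1 + σ * c (n + 1)) * c (n + 1)) hν hβ0 hβ1 hU
    (by simp [hst, state]) (fun n _ => hv n) (fun n hn => ?_) (fun n _ => ?_) (fun n _ => ?_)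
    (fun n _ => ?_)
  · rw [abs_mul, hcabs, mul_one]
    refine hu _ (Finset.mem_Icc.2 ⟨by omega, by omega⟩) _ ?_
    have := hmem n
    rw [Set.mem_Icc] at this ⊢
    rcases hc (n + 1) with h | h <;> rw [h] <;> constructor <;> linarith
  · have := hmem n
    rw [Set.mem_Icc] at this hz
    rw [abs_le]; constructor <;> linarith
  · simp only [hy1 n]
    exact abs_proj_Icc_sub_le hlr _ hz
  · simp only [hy1 n]
    -- The previous iterate already lies in the interval, so projecting cannot lengthen the step
    -- from it.
    refine (abs_proj_Icc_sub_le hlr _ (hmem n)).trans ?_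
    rw [add_sub_cancel_left, abs_mul, abs_of_nonneg (by unfold stepSize; positivity)]

/-- The cost of shrinking the comparator, of playing `y + σ c` and of the difference quotient. -/
theorem comparator_sub_value_le {u : ℝ → ℝ} {L : ℝ≥0} (hξ : 0 < ξ) (hσ : 0 < σ) (hσξ : σ < ξ)
    (hconc : ConcaveOn ℝ (Set.Icc (-ξ) ξ) u) (hL : LipschitzOnWith L u (Set.Icc (-ξ) ξ))
    {x y e : ℝ} (hx : x ∈ Set.Icc (-ξ) ξ) (hy : y ∈ Set.Icc (-(ξ - σ)) (ξ - σ))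
    (he : e = 1 ∨ e = -1) :
    u x - u (y + σ * e)
      ≤ (u (y + σ) - u (y - σ)) / (2 * σ) * ((1 - σ / ξ) * x - y) + 4 * L * σ := by
  have hshift : |x - (1 - σ / ξ) * x| ≤ σ := by
    rw [show x - (1 - σ / ξ) * x = σ * (x / ξ) by ring, abs_mul, abs_of_pos hσ, abs_div,
      abs_of_pos hξ]
    exact mul_le_of_le_one_right hσ.le ((div_le_one hξ).2 (abs_le.2 hx))
  have hx' : (1 - σ / ξ) * x ∈ Set.Icc (-ξ) ξ := by
    have : (1 - σ / ξ) * x ∈ (1 - σ / ξ) • Set.Icc (-ξ) ξ := Set.smul_mem_smul_set hx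
    rw [smul_Icc_neg hξ hσξ] at this
    exact Set.Icc_subset_Icc (by linarith) (by linarith) this
  rw [Set.mem_Icc] at hy
  have hye : y + σ * e ∈ Set.Icc (-ξ) ξ := by
    rcases he with h | h <;> rw [h] <;> constructor <;> linarith
  have hy0 : y ∈ Set.Icc (-ξ) ξ := by constructor <;> linarith
  have lip : ∀ a ∈ Set.Icc (-ξ) ξ, ∀ b ∈ Set.Icc (-ξ) ξ, |a - b| ≤ σ → u a - u b ≤ L * σ :=
    fun a ha b hb hab => by
      have := hL.dist_le_mul a ha b hb
      rw [Real.dist_eq, Real.dist_eq] at this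
      exact (le_abs_self _).trans (this.trans (by gcongr))
  -- The error `4 L σ` is `L σ` for the shrinking, `L σ` for the perturbation and `2 L σ` for the
  -- quotient.
  have h1 := lip _ hx _ hx' hshift
  have h2 := lip _ hy0 _ hye (by rcases he with h | h <;> simp [h, abs_of_pos hσ])
  have h3 := concave_sub_le_symmDiffQuot hconc hL hσ hx'
    (show y + σ ∈ Set.Icc (-ξ) ξ by constructor <;> linarith)
    (show y - σ ∈ Set.Icc (-ξ) ξ by constructor <;> linarith)
  linarith

end Deterministic

/-! ### Averaging over sign sequences -/

/-- The sequence of signs encoded by bits at the indices `1, …, T`; it is `1` elsewhere. -/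
def signs {T : ℕ} (b : Finset.Icc 1 T → Bool) (s : ℕ) : ℝ :=
  if h : s ∈ Finset.Icc 1 T then (if b ⟨s, h⟩ then 1 else -1) else 1

theorem signs_eq_or {T : ℕ} (b : Finset.Icc 1 T → Bool) (s : ℕ) :
    signs b s = 1 ∨ signs b s = -1 := by
  unfold signs; split_ifs <;> simp

/-- Flipping one bit. -/
def flipBit {ι : Type*} [DecidableEq ι] (i : ι) : Equiv.Perm (ι → Bool) :=
  Function.Involutive.toPerm (fun b => Function.update b i (!b i)) fun b => by simp

theorem flipBit_apply {ι : Type*} [DecidableEq ι] (i : ι) (b : ι → Bool) :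
    flipBit i b = Function.update b i (!b i) := rfl

theorem signs_flipBit_self {T : ℕ} (b : Finset.Icc 1 T → Bool) (t : Finset.Icc 1 T) :
    signs (flipBit t b) t = -signs b t := by
  simp only [signs, t.2, dif_pos, flipBit_apply, Subtype.coe_eta, Function.update_self]
  cases b t <;> simp

theorem signs_flipBit_of_ne {T : ℕ} (b : Finset.Icc 1 T → Bool) (t : Finset.Icc 1 T) {s : ℕ}
    (hs : s ≠ t) : signs (flipBit t b) s = signs b s := by
  unfold signs
  by_cases h : s ∈ Finset.Icc 1 T
  · have hne : (⟨s, h⟩ : Finset.Icc 1 T) ≠ t := fun h' => hs (congrArg Subtype.val h')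
    rw [dif_pos h, dif_pos h, flipBit_apply, Function.update_of_ne hne]
  · rw [dif_neg h, dif_neg h]

/-- Averaged over all signs, the one-point estimate is the symmetric difference quotient. -/
theorem sum_signed_value_eq {T : ℕ} (S : Set ℝ) (ν : ℕ → ℝ) (σ α β z : ℝ) (u : ℕ → ℝ → ℝ)
    {t : ℕ} (ht : t ∈ Finset.Icc 1 T) {y : (Finset.Icc 1 T → Bool) → ℕ → ℝ}
    (hy : y = fun b => iterate S ν σ α β u (signs b)) :
    ∑ b, u t (y b t + σ * signs b t) * signs b t * (z - y b t)
      = ∑ b, (u t (y b t + σ) - u t (y b t - σ)) / 2 * (z - y b t) := by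
  have hflip : ∀ b, y (flipBit ⟨t, ht⟩ b) t = y b t := fun b => by
    simp only [hy]
    exact iterate_congr _ _ _ _ _ _ fun s _ hs => signs_flipBit_of_ne b ⟨t, ht⟩ hs.ne
  have hneg : ∀ b, signs (flipBit ⟨t, ht⟩ b) t = -signs b t := fun b =>
    signs_flipBit_self b ⟨t, ht⟩
  set F : (Finset.Icc 1 T → Bool) → ℝ :=
    fun b => u t (y b t + σ * signs b t) * signs b t * (z - y b t) with hF
  have h1 : ∑ b, F b = ∑ b, F (flipBit ⟨t, ht⟩ b) := (Equiv.sum_comp _ F).symm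
  -- Each bit string is averaged with its flip at `t`; the two values of `F` combine into the
  -- symmetric difference.
  have h2 : ∑ b, F b = ∑ b, (F b + F (flipBit ⟨t, ht⟩ b)) / 2 := by
    rw [← Finset.sum_div, Finset.sum_add_distrib, ← h1]; ring
  rw [h2]
  refine Finset.sum_congr rfl fun b _ => ?_
  simp only [hF, hflip, hneg]
  rcases signs_eq_or b t with h | h <;> rw [h]
  · rw [show y b t + σ * -1 = y b t - σ by ring, mul_one σ]; ring
  · rw [neg_neg, show y b t + σ * -1 = y b t - σ by ring, mul_one σ]; ring

/-! ### The law of the signs -/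

section Law

variable {ι Ω : Type*} [MeasurableSpace Ω] {μ : Measure Ω} {X : ι → Ω → ℝ}

/-- The bits telling which of the variables are equal to `1`. -/
def bits (X : ι → Ω → ℝ) (ω : Ω) (i : ι) : Bool :=
  open Classical in decide (X i ω = 1)

theorem measurable_decide_eq_one :
    Measurable (open Classical in fun x : ℝ => decide (x = 1)) := by
  classical
  refine measurable_to_bool ?_
  have : (fun x : ℝ => decide (x = 1)) ⁻¹' {true} = {1} := by ext; simp
  rw [this]
  exact measurableSet_singleton 1

theorem measurable_bits (hX : ∀ i, Measurable (X i)) : Measurable (bits X) :=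
  measurable_pi_lambda _ fun i => measurable_decide_eq_one.comp (hX i)

theorem uniformOn_sign (a : ℝ) (ha : a = 1 ∨ a = -1) :
    uniformOn ({-1, 1} : Set ℝ) {a} = 1 / 2 := by
  classical
  have := uniformOn_apply_finset (s := ({-1, 1} : Finset ℝ)) (t := {a})
  have hne : (-1 : ℝ) ≠ 1 := by norm_num
  push_cast at this
  rw [this, Finset.card_pair hne, Finset.inter_singleton_of_mem (by simp; tauto)]
  simp

theorem ae_eq_sign {Y : Ω → ℝ} (hY : Measurable Y)
    (hlaw : μ.map Y = uniformOn ({-1, 1} : Set ℝ)) : ∀ᵐ ω ∂μ, Y ω = 1 ∨ Y ω = -1 := by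
  have h : uniformOn ({-1, 1} : Set ℝ) ({-1, 1} : Set ℝ)ᶜ = 0 := by
    rw [uniformOn_eq_zero_iff (by simp)]; simp
  rw [← hlaw, Measure.map_apply hY (by measurability)] at h
  have h' : ∀ᵐ ω ∂μ, ω ∉ Y ⁻¹' ({-1, 1} : Set ℝ)ᶜ := measure_eq_zero_iff_ae_notMem.1 h
  filter_upwards [h'] with ω hω
  simp at hω
  tauto

/-- Independence makes the law of the bits a product of fair coins, hence uniform on the cube. -/
theorem map_bits_singleton [Fintype ι] [IsProbabilityMeasure μ] (hX : ∀ i, Measurable (X i))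
    (hlaw : ∀ i, μ.map (X i) = uniformOn ({-1, 1} : Set ℝ)) (hind : iIndepFun X μ)
    (b : ι → Bool) : (μ.map (bits X)) {b} = (1 / 2) ^ Fintype.card ι := by
  classical
  have hB : ∀ i, Measurable (fun ω => bits X ω i) := fun i =>
    (measurable_pi_apply i).comp (measurable_bits hX)
  have hind' : iIndepFun (fun i ω => bits X ω i) μ :=
    hind.comp (fun _ x => decide (x = 1)) fun _ => by
      convert measurable_decide_eq_one
  have hmap := hind'.map_fun_eq_pi_map fun i => (hB i).aemeasurable
  have : ∀ i, IsProbabilityMeasure (μ.map fun ω => bits X ω i) := fun i =>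
    Measure.isProbabilityMeasure_map (hB i).aemeasurable
  change (μ.map fun ω i => bits X ω i) {b} = _
  rw [hmap, Measure.pi_singleton]
  refine (Finset.prod_congr rfl fun i _ => ?_).trans (by rw [Finset.prod_const, Finset.card_univ])
  rw [Measure.map_apply (hB i) (measurableSet_singleton _)]
  have key : ∀ a : ℝ, (a = 1 ∨ a = -1) →
      (∀ x : ℝ, (x = 1 ∨ x = -1) → (decide (x = 1) = b i ↔ x = a)) →
      μ ((fun ω => bits X ω i) ⁻¹' {b i}) = 1 / 2 := fun a ha hab => by
    rw [← uniformOn_sign a ha, ← hlaw i, Measure.map_apply (hX i) (measurableSet_singleton _)]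
    refine measure_congr ?_
    filter_upwards [ae_eq_sign (hX i) (hlaw i)] with ω hω
    have := hab _ hω
    apply propext
    change bits X ω i = b i ↔ X i ω = a
    rw [← this, bits]
  cases hb : b i
  · rw [← hb]
    refine key (-1) (.inr rfl) fun x hx => ?_
    rw [hb]
    rcases hx with rfl | rfl <;> norm_num
  · rw [← hb]
    refine key 1 (.inl rfl) fun x hx => ?_
    rw [hb]
    simp

theorem integrable_comp_bits [Finite ι] [IsProbabilityMeasure μ] (hX : ∀ i, Measurable (X i))
    (F : (ι → Bool) → ℝ) :
    Integrable (fun ω => F (bits X ω)) μ := by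
  have : IsProbabilityMeasure (μ.map (bits X)) :=
    Measure.isProbabilityMeasure_map (measurable_bits hX).aemeasurable
  exact (Integrable.of_finite (μ := μ.map (bits X)) (f := F)).comp_measurable (measurable_bits hX)

theorem integral_comp_bits [Fintype ι] [DecidableEq ι] [IsProbabilityMeasure μ]
    (hX : ∀ i, Measurable (X i))
    (hlaw : ∀ i, μ.map (X i) = uniformOn ({-1, 1} : Set ℝ)) (hind : iIndepFun X μ)
    (F : (ι → Bool) → ℝ) :
    ∫ ω, F (bits X ω) ∂μ = (1 / 2) ^ Fintype.card ι * ∑ b, F b := by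
  have : IsProbabilityMeasure (μ.map (bits X)) :=
    Measure.isProbabilityMeasure_map (measurable_bits hX).aemeasurable
  rw [← integral_map (measurable_bits hX).aemeasurable
    (Integrable.of_finite (μ := μ.map (bits X))).aestronglyMeasurable,
    integral_fintype Integrable.of_finite, Finset.mul_sum]
  refine Finset.sum_congr rfl fun b _ => ?_
  rw [Measure.real, map_bits_singleton hX hlaw hind b, smul_eq_mul]
  simp

end Law

theorem ae_signs_bits_eq {Ω : Type*} [MeasurableSpace Ω] {μ : Measure Ω} {T : ℕ}
    {c : ℕ → Ω → ℝ} (hc : ∀ t ∈ Finset.Icc 1 T, Measurable (c t))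
    (hlaw : ∀ t ∈ Finset.Icc 1 T, μ.map (c t) = uniformOn ({-1, 1} : Set ℝ)) :
    ∀ᵐ ω ∂μ, ∀ s ∈ Finset.Icc 1 T,
      signs (bits (fun t : Finset.Icc 1 T => c t) ω) s = c s ω := by
  have h : ∀ᵐ ω ∂μ, ∀ s : Finset.Icc 1 T, c s ω = 1 ∨ c s ω = -1 :=
    ae_all_iff.2 fun s => ae_eq_sign (hc s s.2) (hlaw s s.2)
  filter_upwards [h] with ω hω s hs
  rcases hω ⟨s, hs⟩ with h | h <;> simp only at h <;> simp only [signs, hs, dif_pos, bits, h] <;>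
    norm_num

/-! ### Expected regret -/

/-- The average regret over all sign sequences. -/
theorem average_regret_le {ξ σ ν β U : ℝ} {L : ℝ≥0} (hξ : 0 < ξ) (hσ : 0 < σ) (hσξ : σ < ξ)
    (hν : 0 < ν) (hβ0 : 0 ≤ β) (hβ1 : β < 1) (hU : 0 ≤ U) {T : ℕ} (hT : 1 ≤ T)
    {u : ℕ → ℝ → ℝ} (hconc : ∀ t ∈ Finset.Icc 1 T, ConcaveOn ℝ (Set.Icc (-ξ) ξ) (u t))
    (hL : ∀ t ∈ Finset.Icc 1 T, LipschitzOnWith L (u t) (Set.Icc (-ξ) ξ))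
    (hu : ∀ t ∈ Finset.Icc 1 T, ∀ z ∈ Set.Icc (-ξ) ξ, |u t z| ≤ U) :
    (1 / 2) ^ T * ∑ b : Finset.Icc 1 T → Bool, regret (Set.Icc (-ξ) ξ) u T
        (action (Set.Icc (-ξ) ξ) (stepSize ν) σ (σ / ξ) β u (signs b))
      ≤ ((2 * ξ) ^ 2 / (2 * ν) + 3 * (U / (1 - β)) ^ 2 * ν + U / (1 - β) * (2 * ξ))
          * √(T : ℝ) / σ + 4 * L * σ * T := by
  set A := (2 * ξ) ^ 2 / (2 * ν) + 3 * (U / (1 - β)) ^ 2 * ν + U / (1 - β) * (2 * ξ) with hA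
  obtain ⟨y, hy⟩ : ∃ y : (Finset.Icc 1 T → Bool) → ℕ → ℝ,
    y = fun b => iterate (Set.Icc (-ξ) ξ) (stepSize ν) σ (σ / ξ) β u (signs b) := ⟨_, rfl⟩
  have hymem : ∀ b t, y b t ∈ Set.Icc (-(ξ - σ)) (ξ - σ) := fun b t => by
    simp only [hy]; exact state_fst_mem hξ hσξ _ _ _ _ _
  have hcard : (1 / 2 : ℝ) ^ T * (Finset.univ : Finset (Finset.Icc 1 T → Bool)).card = 1 := by
    rw [Finset.card_univ]
    simp
  -- The comparator `x` is fixed before averaging, so it does not vary with the signs; the supremum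
  -- is taken only afterwards.
  have hpoint : ∀ x ∈ Set.Icc (-ξ) ξ, ∑ t ∈ Finset.Icc 1 T, u t x
      ≤ (1 / 2) ^ T * ∑ b, ∑ t ∈ Finset.Icc 1 T, u t (y b t + σ * signs b t)
        + (A * √(T : ℝ) / σ + 4 * L * σ * T) := by
    intro x hx
    set z := (1 - σ / ξ) * x with hz
    have hzmem : z ∈ Set.Icc (-(ξ - σ)) (ξ - σ) := by
      rw [← smul_Icc_neg hξ hσξ]; exact Set.smul_mem_smul_set hx
    have h1 : ∀ b, ∑ t ∈ Finset.Icc 1 T, u t x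
        ≤ ∑ t ∈ Finset.Icc 1 T, u t (y b t + σ * signs b t)
          + ∑ t ∈ Finset.Icc 1 T, (u t (y b t + σ) - u t (y b t - σ)) / 2 * (z - y b t) / σ
          + 4 * L * σ * T := fun b => by
      have : ∑ t ∈ Finset.Icc 1 T, (4 * L * σ : ℝ) = 4 * L * σ * T := by
        rw [Finset.sum_const, nsmul_eq_mul, Nat.card_Icc, Nat.add_sub_cancel, mul_comm]
      rw [← this, ← Finset.sum_add_distrib, ← Finset.sum_add_distrib]
      refine Finset.sum_le_sum fun t ht => ?_
      have := comparator_sub_value_le hξ hσ hσξ (hconc t ht) (hL t ht) hx (hymem b t)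
        (signs_eq_or b t)
      have e : (u t (y b t + σ) - u t (y b t - σ)) / (2 * σ) * ((1 - σ / ξ) * x - y b t)
          = (u t (y b t + σ) - u t (y b t - σ)) / 2 * (z - y b t) / σ := by
        rw [hz]; field_simp
      linarith
    have h2 : ∑ b, ∑ t ∈ Finset.Icc 1 T,
          (u t (y b t + σ) - u t (y b t - σ)) / 2 * (z - y b t) / σ
        ≤ ∑ _b : Finset.Icc 1 T → Bool, A * √(T : ℝ) / σ := by
      calc _ = ∑ b, ∑ t ∈ Finset.Icc 1 T,
            u t (y b t + σ * signs b t) * signs b t * (z - y b t) / σ := by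
            rw [Finset.sum_comm]
            conv_rhs => rw [Finset.sum_comm]
            refine Finset.sum_congr rfl fun t ht => ?_
            rw [← Finset.sum_div, ← Finset.sum_div, sum_signed_value_eq _ _ _ _ _ _ _ ht hy]
        _ ≤ _ := by
            refine Finset.sum_le_sum fun b _ => ?_
            rw [← Finset.sum_div]
            gcongr
            exact sum_signed_value_mul_le hξ hσ hσξ hν hβ0 hβ1 hU hT hu (signs_eq_or b) hzmem
              (by rw [hy])
    have h3 := Finset.sum_le_sum fun b (_ : b ∈ Finset.univ) => h1 b
    rw [Finset.sum_add_distrib, Finset.sum_add_distrib] at h3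
    rw [Finset.sum_const, Finset.sum_const, nsmul_eq_mul, nsmul_eq_mul] at h3
    rw [Finset.sum_const, nsmul_eq_mul] at h2
    have hp : (0 : ℝ) ≤ (1 / 2) ^ T := by positivity
    have h5 := mul_le_mul_of_nonneg_left (h3.trans (add_le_add_left (add_le_add_right h2 _) _)) hp
    generalize (((Finset.univ : Finset (Finset.Icc 1 T → Bool)).card : ℕ) : ℝ) = M at *
    generalize (1 / 2 : ℝ) ^ T = p at *
    linear_combination h5 +
      (∑ t ∈ Finset.Icc 1 T, u t x - A * √(T : ℝ) / σ - 4 * L * σ * T) * (-hcard)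
  have hsup : sSup ((fun x => ∑ t ∈ Finset.Icc 1 T, u t x) '' Set.Icc (-ξ) ξ)
      ≤ (1 / 2) ^ T * ∑ b, ∑ t ∈ Finset.Icc 1 T, u t (y b t + σ * signs b t)
        + (A * √(T : ℝ) / σ + 4 * L * σ * T) := by
    refine csSup_le (Set.Nonempty.image _ ⟨0, by constructor <;> linarith⟩) ?_
    rintro _ ⟨x, hx, rfl⟩
    exact hpoint x hx
  simp only [regret, action]
  rw [Finset.sum_sub_distrib, Finset.sum_const, nsmul_eq_mul, mul_sub, ← mul_assoc, hcard, one_mul]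
  simp only [hy] at hsup
  linarith

end BGAM

end

theorem proposition5 (ξ ν β U : ℝ) (L : ℝ≥0)
    (hξ : 0 < ξ) (hν : 0 < ν) (hβ0 : 0 ≤ β) (hβ1 : β < 1) (hU : 0 < U) :
    -- the constant depends on the parameters only, not on the horizon `T`, the utilities `u`,
    -- the bounds `G`, `D` or the probability space
    ∃ C : ℝ, ∀ (T : ℕ), 1 ≤ T →
      ∀ (S : Set ℝ) (σ α : ℝ), S = Set.Icc (-ξ) ξ → σ = BGAM.radius T ξ ξ L U → α = σ / ξ →
      ∀ u : ℕ → ℝ → ℝ,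
      (∀ t ∈ Finset.Icc 1 T, ConcaveOn ℝ S (u t)) →
      (∀ t ∈ Finset.Icc 1 T, DifferentiableOn ℝ (u t) S) →
      (∀ t ∈ Finset.Icc 1 T, LipschitzOnWith L (u t) S) →
      (∀ t ∈ Finset.Icc 1 T, ∀ z ∈ S, |u t z| ≤ U) →
      ∀ (Ω : Type*) [MeasurableSpace Ω] (μ : Measure Ω) [IsProbabilityMeasure μ]
        (c : ℕ → Ω → ℝ),
      -- `c^1, …, c^T` are independent and uniform on the unit sphere `{-1, 1}` of `ℝ`
      (∀ t ∈ Finset.Icc 1 T, Measurable (c t)) →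
      (∀ t ∈ Finset.Icc 1 T, μ.map (c t) = uniformOn ({-1, 1} : Set ℝ)) →
      iIndepFun (fun t : Finset.Icc 1 T => c t) μ →
      ∀ (G D : ℝ), 0 < D →
      (∀ t ∈ Finset.Icc 1 T, ∀ᵐ ω ∂μ,
        |BGAM.gradEst σ (u t)
          (BGAM.iterate S (BGAM.stepSize ν) σ α β u (fun s => c s ω) t) (c t ω)| ≤ G) →
      (∀ i ∈ Finset.Icc 1 T, ∀ j ∈ Finset.Icc 1 T, ∀ᵐ ω ∂μ,
        |BGAM.iterate S (BGAM.stepSize ν) σ α β u (fun s => c s ω) i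
          - BGAM.iterate S (BGAM.stepSize ν) σ α β u (fun s => c s ω) j| ≤ D) →
      Integrable (fun ω => BGAM.regret S u T
        (BGAM.action S (BGAM.stepSize ν) σ α β u (fun s => c s ω))) μ ∧
      ∫ ω, BGAM.regret S u T
        (BGAM.action S (BGAM.stepSize ν) σ α β u (fun s => c s ω)) ∂μ
        ≤ C * ((T : ℝ) ^ (3 / 4 : ℝ) * √(1 + Real.log T)) := by
  set k := √(ξ * U * ξ / (3 * (L * ξ + U))) with hk
  set A := (2 * ξ) ^ 2 / (2 * ν) + 3 * (U / (1 - β)) ^ 2 * ν + U / (1 - β) * (2 * ξ) with hA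
  have hk0 : 0 < k := Real.sqrt_pos.2 (by positivity)
  -- In fact `k² ≤ ξ² / 3`. Since `σ ≤ k`, the shrunken interval is nondegenerate for every `T ≥ 1`.
  have hkξ : k < ξ := by
    rw [hk, Real.sqrt_lt' hξ, div_lt_iff₀ (by positivity)]
    have : 0 ≤ (L : ℝ) * ξ := by positivity
    nlinarith [mul_pos hξ hξ, mul_pos (mul_pos hξ hξ) hU]
  have hA0 : 0 ≤ A := by
    have : 0 < 1 - β := by linarith
    positivity
  -- The coefficients of `T^(3/4)` in `A √T / σ` and `4 L σ T` when `σ = k T^(-1/4)`.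
  refine ⟨A / k + 4 * L * k, ?_⟩
  rintro T hT S σ α rfl hσ rfl u hconc - hL hu Ω _ μ _ c hc hlaw hind G D - - -
  have hT1 : (1 : ℝ) ≤ T := by exact_mod_cast hT
  have hT0 : (0 : ℝ) < T := by linarith
  have hσk : σ = (T : ℝ) ^ (-(1 / 4) : ℝ) * k := hσ
  have hσ0 : 0 < σ := by rw [hσk]; positivity
  have hσξ : σ < ξ := by
    rw [hσk]
    exact (mul_le_of_le_one_left hk0.le (Real.rpow_le_one_of_one_le_of_nonpos hT1
      (by norm_num))).trans_lt hkξ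
  set X : Finset.Icc 1 T → Ω → ℝ := fun t => c t with hX
  have hXm : ∀ i, Measurable (X i) := fun i => hc i i.2
  have hae : (fun ω => BGAM.regret (Set.Icc (-ξ) ξ) u T
        (BGAM.action (Set.Icc (-ξ) ξ) (BGAM.stepSize ν) σ (σ / ξ) β u (fun s => c s ω)))
      =ᵐ[μ] fun ω => BGAM.regret (Set.Icc (-ξ) ξ) u T (BGAM.action (Set.Icc (-ξ) ξ)
        (BGAM.stepSize ν) σ (σ / ξ) β u (BGAM.signs (BGAM.bits X ω))) := by
    filter_upwards [BGAM.ae_signs_bits_eq hc hlaw] with ω hω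
    exact BGAM.regret_action_congr _ _ _ _ _ _ fun s hs => (hω s hs).symm
  refine ⟨(BGAM.integrable_comp_bits hXm fun b => BGAM.regret (Set.Icc (-ξ) ξ) u T
    (BGAM.action (Set.Icc (-ξ) ξ) (BGAM.stepSize ν) σ (σ / ξ) β u (BGAM.signs b))).congr
      hae.symm, ?_⟩
  rw [integral_congr_ae hae, BGAM.integral_comp_bits hXm (fun i => hlaw i i.2) hind fun b =>
    BGAM.regret (Set.Icc (-ξ) ξ) u T
      (BGAM.action (Set.Icc (-ξ) ξ) (BGAM.stepSize ν) σ (σ / ξ) β u (BGAM.signs b)),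
    Fintype.card_coe, Nat.card_Icc, Nat.add_sub_cancel]
  refine (BGAM.average_regret_le hξ hσ0 hσξ hν hβ0 hβ1 hU.le hT hconc hL hu).trans ?_
  have e1 : √(T : ℝ) / σ = (T : ℝ) ^ (3 / 4 : ℝ) / k := by
    rw [hσk, Real.sqrt_eq_rpow, ← div_div, ← Real.rpow_sub hT0]; norm_num
  have e2 : σ * T = k * (T : ℝ) ^ (3 / 4 : ℝ) := by
    have : (T : ℝ) ^ (-(1 / 4) : ℝ) * T = (T : ℝ) ^ (3 / 4 : ℝ) := by
      rw [← Real.rpow_add_one hT0.ne']; norm_num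
    rw [hσk, mul_right_comm, this, mul_comm]
  have e3 : A * √(T : ℝ) / σ + 4 * L * σ * T = (A / k + 4 * L * k) * (T : ℝ) ^ (3 / 4 : ℝ) := by
    rw [mul_div_assoc, e1, mul_assoc (4 * (L : ℝ)), e2]; ring
  rw [e3]
  -- The bound holds without the logarithm, which enters only as a factor at least `1`.
  have hlog : 1 ≤ √(1 + Real.log T) := Real.one_le_sqrt.2 (by linarith [Real.log_nonneg hT1])
  gcongr
  exact le_mul_of_one_le_right (by positivity) hlog
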